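/- **Setting.** For every $m\ge 1$ let $p_{1,m},\dots,p_{m,m}$ be $[0,1]$-valued random variables ($p$-values) on a probability space $(\Omega_m,\mathcal A_m,P_m)$, and let $\{1,\dots,m\}=I_{0,m}\sqcup I_{1,m}$ be a nonrandom partition into true and false nulls, with $m_j=\#I_{j,m}$. Assume that the vectors $(p_{i,m})_{i\in I_{0,m}}$ and $(p_{i,m})_{i\in I_{1,m}}$ are independent (the dependence within the second is arbitrary) and that the $p_{i,m}$, $i\in I_{0,m}$, are independent and uniformly distributed on $[0,1]$. For $j=0,1$ let $\widehat F_{j,m}(x)=m_j^{-1}\sum_{i\in I_{j,m}}\mathbf 1\{p_{i,m}\le x\}$ (read as $0$ if $m_j=0$), let $\widehat F_m$ be the empirical distribution function of all $m$ $p$-values, and let $R_m(x)=m\widehat F_m(x)$. Fix $0<\alpha<1$ and $\alpha\le\lambda<1$. Let $\widehat m_0=\widehat m_0\big((\widehat F_m(t))_{t\ge\lambda}\big)>0$ be, for each $m$, a measurable function of $(\widehat F_m(t))_{t\ge\lambda}$. The adaptive step-up test has the critical values $\widehat\alpha_{i:m}=\min\{\tfrac{i}{\widehat m_0}\alpha,\lambda\}$,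 $i=0,\dots,m$. With the ordered $p$-values $p_{1:m}\le\dots\le p_{m:m}$ and $p_{0:m}:=0$ it has $$R_m=\max\{i\in\{0,\dots,m\}: p_{i:m}\le\widehat\alpha_{i:m}\}$$ rejections, and it rejects the $i$-th null iff $p_{i,m}\le\widehat\alpha_{R_m:m}$. Let $V_m=\#\{i\in I_{0,m}: p_{i,m}\le\widehat\alpha_{R_m:m}\}$ be the number of false rejections. The tests are called *consistent* if $\frac{V_m}{R_m}-E\big(\frac{V_m}{R_m}\big)\to 0$ in $P_m$-probability as $m\to\infty$, where $\frac00=0$. **Theorem.** Assume that, as $m\to\infty$, * (A1) $m_0/m\to\kappa_0$ for some $\kappa_0\in(0,1]$; * (A3) there is $K>0$ with $\widehat m_0\le Km$ for all $m\ge1$; * (A4) there is a constant $C>1$ with $P_m\big(\widehat m_0\ge\tfrac{C\alpha}{\lambda}\max\{R_m(\lambda),1\}\big)\to1$; * $\widehat m_0/m\to C_0$ in $P_m$-probability for some constant $C_0\in\mathbb R$. Let $\delta>0$ and let $(t_m)_{m\ge1}$ be a sequence in $(0,\lambda)$ with $m\,t_m\to\infty$ and $$P_m\Big(\frac{m_1}{m}\,\frac{\widehat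 F_{1,m}(t_m)}{t_m}\ge\delta-\kappa_0+\frac{C_0}{\alpha}\Big)\to1 .$$ Then $V_m\to\infty$ in $P_m$-probability, that is, $P_m(V_m>x)\to1$ for every $x\in\mathbb R$, and the tests are consistent. -/

import Mathlib

open MeasureTheory ProbabilityTheory Filter Topology

noncomputable section

namespace StepUp

/-- Convergence in `P m`-probability, as `m → ∞`, of real random variables `X m`, each living on its
own probability space, to a constant `c`. -/
def TendstoInProb {Ω : ℕ → Type*} [∀ m, MeasurableSpace (Ω m)] (P : ∀ m, Measure (Ω m))
    (X : ∀ m, Ω m → ℝ) (c : ℝ) : Prop :=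
  ∀ ε : ℝ, 0 < ε → Tendsto (fun m => P m {ω | ε ≤ |X m ω - c|}) atTop (𝓝 0)

/-- Divergence to `∞` in `P m`-probability, as `m → ∞`. -/
def TendstoInftyInProb {Ω : ℕ → Type*} [∀ m, MeasurableSpace (Ω m)] (P : ∀ m, Measure (Ω m))
    (X : ∀ m, Ω m → ℝ) : Prop :=
  ∀ x : ℝ, Tendsto (fun m => P m {ω | x < X m ω}) atTop (𝓝 1)

/-- The basic independence model for `m` p-values `p i`, where `I₀` is the set of true nulls and its
complement is the set of false nulls. -/
structure BasicIndependence {m : ℕ} {Ω : Type*} [MeasurableSpace Ω] (P : Measure Ω)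
    (p : Fin m → Ω → ℝ) (I₀ : Finset (Fin m)) : Prop where
  measurable : ∀ i, Measurable (p i)
  mem_Icc : ∀ i ω, p i ω ∈ Set.Icc (0 : ℝ) 1
  /-- The vector of true-null p-values is independent of the vector of false-null p-values. -/
  indep_true_false :
    IndepFun (fun ω (i : {i // i ∈ I₀}) => p i ω) (fun ω (i : {i // i ∉ I₀}) => p i ω) P
  /-- The true-null p-values are independent. -/
  indep_true : iIndepFun (fun (i : {i // i ∈ I₀}) => p i) P
  /-- The true-null p-values are uniformly distributed on `[0, 1]`. -/
  uniform_true : ∀ i ∈ I₀, ∀ x ∈ Set.Icc (0 : ℝ) 1, P {ω | p i ω ≤ x} = ENNReal.ofReal x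

/-- Number of indices in `S` with `x i ≤ t`. -/
def countLE {m : ℕ} (x : Fin m → ℝ) (S : Finset (Fin m)) (t : ℝ) : ℕ :=
  (S.filter fun i => x i ≤ t).card

/-- Empirical distribution function, at `t`, of the values `x i`, `i ∈ S`
(`0` if `S` is empty). -/
def ecdf {m : ℕ} (x : Fin m → ℝ) (S : Finset (Fin m)) (t : ℝ) : ℝ :=
  (countLE x S t : ℝ) / (S.card : ℝ)

/-- The estimator `m̂₀`: a function `est` of the restriction to `[lam, ∞)` of the empirical
distribution function of all p-values. -/
def mHat {m : ℕ} (lam : ℝ) (est : (Set.Ici lam → ℝ) → ℝ) (x : Fin m → ℝ) : ℝ :=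
  est fun t => ecdf x Finset.univ t

/-- The `i`-th smallest of the values `x 1, …, x m` for `1 ≤ i ≤ m`; it is `0` for `i = 0`
(and for the irrelevant `i > m`). -/
def orderStat {m : ℕ} (x : Fin m → ℝ) (i : ℕ) : ℝ :=
  if h : 0 < i ∧ i ≤ m then x (Tuple.sort x ⟨i - 1, by omega⟩) else 0

/-- The data driven critical values `min {(i / m̂₀) α, lam}`; the value at `i = 0` is `0`
for `lam ≥ 0`. -/
def critVal (α lam mhat : ℝ) (i : ℕ) : ℝ := min ((i : ℝ) / mhat * α) lam

open Classical in
/-- Number of rejections of the step-up test with critical values `c`: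
the largest `i ∈ {0, …, m}` such that the `i`-th order statistic is at most `c i`. -/
def numReject {m : ℕ} (x : Fin m → ℝ) (c : ℕ → ℝ) : ℕ :=
  Nat.findGreatest (fun i => orderStat x i ≤ c i) m

/-- Number of rejections `R_m` of the adaptive step-up test. -/
def R {m : ℕ} (α lam : ℝ) (est : (Set.Ici lam → ℝ) → ℝ) (x : Fin m → ℝ) : ℕ :=
  numReject x (critVal α lam (mHat lam est x))

/-- Number of false rejections `V_m` of the adaptive step-up test: the `i`-th null is rejected iff
`x i` is at most the critical value with index `R_m`. -/
def V {m : ℕ} (α lam : ℝ) (est : (Set.Ici lam → ℝ) → ℝ) (I₀ : Finset (Fin m))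
    (x : Fin m → ℝ) : ℕ :=
  countLE x I₀ (critVal α lam (mHat lam est x) (R α lam est x))

/-- The false discovery proportion `V_m / R_m`, with `0 / 0 = 0`. -/
def FDP {m : ℕ} (α lam : ℝ) (est : (Set.Ici lam → ℝ) → ℝ) (I₀ : Finset (Fin m))
    (x : Fin m → ℝ) : ℝ :=
  (V α lam est I₀ x : ℝ) / (R α lam est x : ℝ)

/-- Consistency of the tests: `V_m / R_m - E (V_m / R_m) → 0` in `P m`-probability. -/
def Consistent {Ω : ℕ → Type*} [∀ m, MeasurableSpace (Ω m)] (P : ∀ m, Measure (Ω m))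
    (p : ∀ m, Fin m → Ω m → ℝ) (I₀ : ∀ m, Finset (Fin m)) (α lam : ℝ)
    (est : ℕ → (Set.Ici lam → ℝ) → ℝ) : Prop :=
  TendstoInProb P
    (fun m ω => FDP α lam (est m) (I₀ m) (fun i => p m i ω)
      - ∫ ω', FDP α lam (est m) (I₀ m) (fun i => p m i ω') ∂(P m)) 0

end StepUp

end

/-! Let `N(s)` and `N₀(s)` be the numbers of all p-values and of true-null p-values `≤ s`.
Chebyshev's inequality on a geometric grid starting at `t_m` gives `N₀(s) / (m s) → κ₀` uniformly
over `s ∈ [t_m, 1]` with probability tending to one, since the failure probabilities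
`1 / (η² m s)` sum to `O(1 / (m t_m))`; hence the convergence also holds at random points `s`.
The lower bound on the false nulls pushes `N(t_m) / (m t_m)` above `m̂₀ / (m α)`, so the rejection
threshold is at least `t_m`, whence `V ≥ N₀(t_m) → ∞`. Since `m̂₀ ≥ α N(lam) / lam`, the truncation
at `lam` is inactive, so the threshold is `s = α R / m̂₀` and `V / R = α N₀(s) / (s m̂₀)`, which
tends to `α κ₀ / C₀`, where `C₀ ≥ α κ₀ > 0`. Bounded variables that converge in probability to a
constant have expectations converging to the same constant. -/

namespace StepUp

section Deterministic

variable {m : ℕ} (x : Fin m → ℝ) (S : Finset (Fin m))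

lemma countLE_mono : Monotone (countLE x S) :=
  fun _ _ h => Finset.card_le_card (Finset.monotone_filter_right _ fun _ _ hi => hi.trans h)

lemma countLE_le_card (s : ℝ) : countLE x S s ≤ S.card :=
  Finset.card_filter_le _ _

lemma countLE_le_countLE_univ (s : ℝ) : countLE x S s ≤ countLE x Finset.univ s :=
  Finset.card_le_card (Finset.filter_subset_filter _ (Finset.subset_univ S))

lemma countLE_univ_le (s : ℝ) : countLE x Finset.univ s ≤ m :=
  (countLE_le_card x _ s).trans_eq (Finset.card_fin m)

lemma countLE_add_countLE_compl (s : ℝ) :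
    countLE x S s + countLE x Sᶜ s = countLE x Finset.univ s := by
  simp only [countLE]
  rw [← Finset.card_union_of_disjoint
    (Finset.disjoint_filter_filter disjoint_compl_right), ← Finset.filter_union,
    Finset.union_compl]

lemma card_mul_ecdf (s : ℝ) : (S.card : ℝ) * ecdf x S s = countLE x S s := by
  rcases S.eq_empty_or_nonempty with rfl | hS
  · simp [countLE]
  · exact mul_div_cancel₀ _ (Nat.cast_ne_zero.2 hS.card_ne_zero)

lemma countLE_comp_perm (e : Equiv.Perm (Fin m)) (s : ℝ) :
    countLE (x ∘ e) Finset.univ s = countLE x Finset.univ s :=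
  Finset.card_equiv e (by simp)

lemma orderStat_le_iff {c : ℕ → ℝ} (h0 : 0 ≤ c 0) {i : ℕ} (him : i ≤ m) :
    orderStat x i ≤ c i ↔ i ≤ countLE x Finset.univ (c i) := by
  rcases i with _ | i
  · simpa [orderStat] using h0
  · rw [← countLE_comp_perm x (Tuple.sort x), orderStat, dif_pos ⟨i.succ_pos, him⟩]
    exact (Tuple.lt_card_le_iff_apply_le_of_monotone (j := ⟨i, him⟩)
      (Tuple.monotone_sort x)).symm

/-- The rejection threshold `c_R` of the step-up test with critical values `c`, where `R` is its
number of rejections. -/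
noncomputable def cutoff (c : ℕ → ℝ) : ℝ := c (numReject x c)

/-- The false discovery proportion, with `0 / 0 = 0`, of the step-up test with arbitrary critical
values `c`, where `S` is the set of true nulls. -/
noncomputable def fdp (c : ℕ → ℝ) : ℝ := (countLE x S (cutoff x c) : ℝ) / (numReject x c : ℝ)

variable {c : ℕ → ℝ}

lemma numReject_le_countLE_cutoff (h0 : 0 ≤ c 0) :
    numReject x c ≤ countLE x Finset.univ (cutoff x c) := by
  classical
  refine (orderStat_le_iff x h0 (Nat.findGreatest_le m)).1 ?_
  exact Nat.findGreatest_spec (P := fun i => orderStat x i ≤ c i) (Nat.zero_le m)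
    (by simpa [orderStat] using h0)

lemma countLE_le_numReject (h0 : 0 ≤ c 0) {s : ℝ} (hs : s ≤ c (countLE x Finset.univ s)) :
    countLE x Finset.univ s ≤ numReject x c :=
  Nat.le_findGreatest (countLE_univ_le x s)
    ((orderStat_le_iff x h0 (countLE_univ_le x s)).2 (countLE_mono x _ hs))

lemma le_cutoff (h0 : 0 ≤ c 0) (hc : Monotone c) {s : ℝ} (hs : s ≤ c (countLE x Finset.univ s)) :
    s ≤ cutoff x c :=
  hs.trans (hc (countLE_le_numReject x h0 hs))

lemma countLE_cutoff (h0 : 0 ≤ c 0) (hc : Monotone c) :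
    countLE x Finset.univ (cutoff x c) = numReject x c :=
  (countLE_le_numReject x h0 (hc (numReject_le_countLE_cutoff x h0))).antisymm
    (numReject_le_countLE_cutoff x h0)

lemma abs_fdp_le_one (h0 : 0 ≤ c 0) (hc : Monotone c) : |fdp x S c| ≤ 1 := by
  have hle : countLE x S (cutoff x c) ≤ numReject x c :=
    (countLE_le_countLE_univ x S _).trans_eq (countLE_cutoff x h0 hc)
  rw [fdp, abs_of_nonneg (by positivity)]
  exact div_le_one_of_le₀ (Nat.cast_le.2 hle) (Nat.cast_nonneg _)

variable {α lam M : ℝ}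

lemma critVal_zero_nonneg (hlam : 0 ≤ lam) : 0 ≤ critVal α lam M 0 := by
  simp [critVal, hlam]

lemma critVal_mono (hα : 0 ≤ α) (hM : 0 ≤ M) : Monotone (critVal α lam M) :=
  fun _ _ h => min_le_min_right _ (by gcongr)

lemma cutoff_critVal_le : cutoff x (critVal α lam M) ≤ lam := min_le_right _ _

lemma le_cutoff_critVal (hα : 0 ≤ α) (hM : 0 < M) {s : ℝ} (hs : 0 ≤ s) (hsl : s ≤ lam)
    (h : s * M ≤ countLE x Finset.univ s * α) : s ≤ cutoff x (critVal α lam M) := by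
  refine le_cutoff x (critVal_zero_nonneg (hs.trans hsl)) (critVal_mono hα hM.le) (le_min ?_ hsl)
  rwa [div_mul_eq_mul_div, le_div_iff₀ hM]

/-- The truncation at `lam` is inactive: every rejected p-value is at most `lam`, so the number of
rejections is at most the number of p-values below `lam`. -/
lemma cutoff_critVal_eq (hα : 0 ≤ α) (hlam : 0 ≤ lam) (hM : 0 < M)
    (h : α * countLE x Finset.univ lam ≤ lam * M) :
    cutoff x (critVal α lam M) = numReject x (critVal α lam M) / M * α := by
  refine min_eq_left ?_
  have hR : numReject x (critVal α lam M) ≤ countLE x Finset.univ lam :=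
    (countLE_cutoff x (critVal_zero_nonneg hlam) (critVal_mono hα hM.le)).symm.trans_le
      (countLE_mono x _ (cutoff_critVal_le x))
  rw [div_mul_eq_mul_div, div_le_iff₀ hM, mul_comm _ α]
  exact le_trans (by gcongr) h

lemma fdp_critVal_eq (hα : 0 < α) (hlam : 0 ≤ lam) (hM : 0 < M)
    (h : α * countLE x Finset.univ lam ≤ lam * M) :
    fdp x S (critVal α lam M) =
      α * (countLE x S (cutoff x (critVal α lam M)) / (M * cutoff x (critVal α lam M))) := by
  have hR : (numReject x (critVal α lam M) : ℝ) = M * cutoff x (critVal α lam M) / α := by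
    rw [cutoff_critVal_eq x hα.le hlam hM h]
    field_simp
  rw [fdp, hR]
  field_simp

end Deterministic

section Measurability

variable {m : ℕ} {Ω : Type*} [MeasurableSpace Ω] {p : Fin m → Ω → ℝ}

lemma measurable_countLE (hp : ∀ i, Measurable (p i)) (S : Finset (Fin m)) {s : Ω → ℝ}
    (hs : Measurable s) : Measurable fun ω => countLE (fun i => p i ω) S (s ω) := by
  simp only [countLE, Finset.card_filter]
  exact Finset.measurable_sum _ fun i _ =>
    Measurable.ite (measurableSet_le (hp i) hs) measurable_const measurable_const

lemma measurable_cast_countLE (hp : ∀ i, Measurable (p i)) (S : Finset (Fin m)) {s : Ω → ℝ}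
    (hs : Measurable s) : Measurable fun ω => (countLE (fun i => p i ω) S (s ω) : ℝ) :=
  Measurable.of_discrete.comp (measurable_countLE hp S hs)

lemma measurable_ecdf (hp : ∀ i, Measurable (p i)) (S : Finset (Fin m)) (s : ℝ) :
    Measurable fun ω => ecdf (fun i => p i ω) S s :=
  (measurable_cast_countLE hp S measurable_const).div_const _

lemma measurable_mHat (hp : ∀ i, Measurable (p i)) {lam : ℝ} {est : (Set.Ici lam → ℝ) → ℝ}
    (hest : Measurable est) : Measurable fun ω => mHat lam est fun i => p i ω :=
  hest.comp (measurable_pi_lambda _ fun s => measurable_ecdf hp Finset.univ s)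

lemma measurable_critVal (α lam : ℝ) {M : Ω → ℝ} (hM : Measurable M) (i : ℕ) :
    Measurable fun ω => critVal α lam (M ω) i :=
  ((hM.const_div _).mul_const _).min measurable_const

variable {c : Ω → ℕ → ℝ}

lemma measurable_numReject (hp : ∀ i, Measurable (p i)) (h0 : ∀ ω, 0 ≤ c ω 0)
    (hc : ∀ i, Measurable fun ω => c ω i) :
    Measurable fun ω => numReject (fun i => p i ω) (c ω) := by
  classical
  refine measurable_findGreatest (p := fun ω i => orderStat (fun i => p i ω) i ≤ c ω i)
    fun k hk => ?_
  simp only [orderStat_le_iff _ (h0 _) hk]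
  exact measurableSet_le measurable_const (measurable_countLE hp _ (hc k))

lemma measurable_cutoff (hp : ∀ i, Measurable (p i)) (h0 : ∀ ω, 0 ≤ c ω 0)
    (hc : ∀ i, Measurable fun ω => c ω i) :
    Measurable fun ω => cutoff (fun i => p i ω) (c ω) :=
  (measurable_from_prod_countable_left (f := fun z : Ω × ℕ => c z.1 z.2) hc).comp
    (measurable_id.prodMk (measurable_numReject hp h0 hc))

lemma measurable_fdp (hp : ∀ i, Measurable (p i)) (S : Finset (Fin m)) (h0 : ∀ ω, 0 ≤ c ω 0)
    (hc : ∀ i, Measurable fun ω => c ω i) :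
    Measurable fun ω => fdp (fun i => p i ω) S (c ω) :=
  (measurable_cast_countLE hp S (measurable_cutoff hp h0 hc)).div
    (Measurable.of_discrete.comp (measurable_numReject hp h0 hc))

end Measurability

section WithHighProbability

variable {Ω : ℕ → Type*} [∀ m, MeasurableSpace (Ω m)]

/-- The filter of the events that hold with probability tending to one. It lives on the disjoint
union of the sample spaces, so that convergence in probability is convergence along a filter. -/
def whp (P : ∀ m, Measure (Ω m)) : Filter (Σ m, Ω m) :=
  comk (fun A => Tendsto (fun m => P m (Sigma.mk m ⁻¹' A)) atTop (𝓝 0))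
    (by simp)
    (fun _ hA _ hBA => tendsto_of_tendsto_of_tendsto_of_le_of_le tendsto_const_nhds hA
      (fun _ => zero_le) fun _ => measure_mono (Set.preimage_mono hBA))
    (fun _ hA _ hB => tendsto_of_tendsto_of_tendsto_of_le_of_le tendsto_const_nhds
      (add_zero (0 : ENNReal) ▸ hA.add hB) (fun _ => zero_le) fun _ => measure_union_le _ _)

variable {P : ∀ m, Measure (Ω m)}

lemma eventually_whp {q : (Σ m, Ω m) → Prop} :
    (∀ᶠ z in whp P, q z) ↔ Tendsto (fun m => P m {ω | ¬ q ⟨m, ω⟩}) atTop (𝓝 0) := Iff.rfl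

lemma tendsto_fst_whp : Tendsto Sigma.fst (whp P) atTop := by
  refine tendsto_atTop.2 fun n => eventually_whp.2 (tendsto_const_nhds.congr' ?_)
  filter_upwards [eventually_ge_atTop n] with m hm
  simp [hm]

lemma tendstoInProb_iff {X : ∀ m, Ω m → ℝ} {c : ℝ} :
    TendstoInProb P X c ↔ Tendsto (fun z : Σ m, Ω m => X z.1 z.2) (whp P) (𝓝 c) := by
  simp only [Metric.tendsto_nhds, eventually_whp, Real.dist_eq, not_lt]
  rfl

variable [∀ m, IsProbabilityMeasure (P m)]

instance whp_neBot : (whp P).NeBot := by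
  refine ⟨fun h => ?_⟩
  have hfalse : ∀ᶠ _ in whp P, False := h ▸ eventually_bot
  simpa using eventually_whp.1 hfalse

lemma eventually_whp_of_tendsto_one {q : ∀ m, Ω m → Prop}
    (hq : ∀ᶠ m in atTop, MeasurableSet {ω | q m ω})
    (h : Tendsto (fun m => P m {ω | q m ω}) atTop (𝓝 1)) : ∀ᶠ z in whp P, q z.1 z.2 := by
  have hsub := ENNReal.Tendsto.sub (tendsto_const_nhds (x := 1)) h (Or.inl ENNReal.one_ne_top)
  rw [tsub_self] at hsub
  exact eventually_whp.2 (hsub.congr' (hq.mono fun m hm => (prob_compl_eq_one_sub hm).symm))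

lemma tendsto_one_of_eventually_whp {q : ∀ m, Ω m → Prop} (h : ∀ᶠ z in whp P, q z.1 z.2) :
    Tendsto (fun m => P m {ω | q m ω}) atTop (𝓝 1) := by
  have hsub := ENNReal.Tendsto.sub (tendsto_const_nhds (x := 1)) (eventually_whp.1 h)
    (Or.inl ENNReal.one_ne_top)
  rw [tsub_zero] at hsub
  refine tendsto_of_tendsto_of_tendsto_of_le_of_le hsub tendsto_const_nhds (fun m => ?_)
    fun m => prob_le_one
  rw [tsub_le_iff_right, ← measure_univ (μ := P m), ← Set.union_compl_self {ω | q m ω}]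
  exact measure_union_le _ _

lemma tendstoInftyInProb_of_tendsto {X : ∀ m, Ω m → ℝ}
    (h : Tendsto (fun z : Σ m, Ω m => X z.1 z.2) (whp P) atTop) : TendstoInftyInProb P X :=
  fun b => tendsto_one_of_eventually_whp (h.eventually_gt_atTop b)

end WithHighProbability

lemma abs_integral_sub_le {Ω : Type*} [MeasurableSpace Ω] {P : Measure Ω} [IsProbabilityMeasure P]
    {X : Ω → ℝ} (hX : Measurable X) {b : ℝ} (hb : ∀ ω, |X ω| ≤ b) (c : ℝ) {ε : ℝ} (hε : 0 ≤ ε) :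
    |∫ ω, X ω ∂P - c| ≤ ε + P.real {ω | ε ≤ |X ω - c|} * (b + |c|) := by
  set A : Set Ω := {ω | ε ≤ |X ω - c|}
  have hA : MeasurableSet A := measurableSet_le measurable_const (by fun_prop)
  have hint : Integrable X P := .of_bound hX.aestronglyMeasurable b (.of_forall hb)
  have hintA : Integrable (A.indicator fun _ => b + |c|) P := (integrable_const _).indicator hA
  have hpt : ∀ ω, |X ω - c| ≤ ε + A.indicator (fun _ => b + |c|) ω := fun ω => by
    by_cases hω : ω ∈ A
    · rw [Set.indicator_of_mem hω]
      linarith [abs_sub (X ω) c, hb ω]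
    · rw [Set.indicator_of_notMem hω, add_zero]
      exact (not_le.1 hω).le
  calc |∫ ω, X ω ∂P - c| = |∫ ω, (X ω - c) ∂P| := by
        rw [integral_sub hint (integrable_const c), integral_const, probReal_univ, one_smul]
    _ ≤ ∫ ω, |X ω - c| ∂P := abs_integral_le_integral_abs
    _ ≤ ∫ ω, (ε + A.indicator (fun _ => b + |c|) ω) ∂P :=
        integral_mono (hint.sub (integrable_const c)).abs ((integrable_const _).add hintA) hpt
    _ = ε + P.real A * (b + |c|) := by
        rw [integral_add (integrable_const _) hintA, integral_indicator_const _ hA,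
          integral_const, probReal_univ, one_smul, smul_eq_mul]

section BoundedConvergence

variable {Ω : ℕ → Type*} [∀ m, MeasurableSpace (Ω m)] {P : ∀ m, Measure (Ω m)}
  [∀ m, IsProbabilityMeasure (P m)] {X : ∀ m, Ω m → ℝ} {b c : ℝ}

lemma tendsto_integral_of_tendsto_whp (hX : ∀ᶠ m in atTop, Measurable (X m))
    (hb : ∀ᶠ m in atTop, ∀ ω, |X m ω| ≤ b)
    (h : Tendsto (fun z : Σ m, Ω m => X z.1 z.2) (whp P) (𝓝 c)) :
    Tendsto (fun m => ∫ ω, X m ω ∂(P m)) atTop (𝓝 c) := by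
  refine Metric.tendsto_nhds.2 fun ε hε => ?_
  have hprob : Tendsto (fun m => ε / 2 + (P m).real {ω | ε / 2 ≤ |X m ω - c|} * (b + |c|)) atTop
      (𝓝 (ε / 2 + 0 * (b + |c|))) :=
    (((ENNReal.tendsto_toReal ENNReal.zero_ne_top).comp
      (tendstoInProb_iff.2 h (ε / 2) (half_pos hε))).mul_const _).const_add _
  filter_upwards [hX, hb, hprob.eventually_lt_const (show _ < ε by linarith)] with m hXm hbm hm
  exact (abs_integral_sub_le hXm hbm c (half_pos hε).le).trans_lt hm

lemma tendstoInProb_sub_integral (hX : ∀ᶠ m in atTop, Measurable (X m))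
    (hb : ∀ᶠ m in atTop, ∀ ω, |X m ω| ≤ b)
    (h : Tendsto (fun z : Σ m, Ω m => X z.1 z.2) (whp P) (𝓝 c)) :
    TendstoInProb P (fun m ω => X m ω - ∫ ω', X m ω' ∂(P m)) 0 :=
  tendstoInProb_iff.2 <| by
    simpa only [sub_self, Function.comp_def] using
      h.sub ((tendsto_integral_of_tendsto_whp hX hb h).comp tendsto_fst_whp)

end BoundedConvergence

section UniformNulls

/-- A weak form of `BasicIndependence`: the p-values with index in `S` are uniformly distributed on
`[0, 1]` and pairwise independent, and the other ones are only measurable. -/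
structure PairwiseUniform {m : ℕ} {Ω : Type*} [MeasurableSpace Ω] (P : Measure Ω)
    (p : Fin m → Ω → ℝ) (S : Finset (Fin m)) : Prop where
  measurable : ∀ i, Measurable (p i)
  pairwise_indepFun : (S : Set (Fin m)).Pairwise fun i j => p i ⟂ᵢ[P] p j
  measure_le : ∀ i ∈ S, ∀ s ∈ Set.Icc (0 : ℝ) 1, P {ω | p i ω ≤ s} = ENNReal.ofReal s

lemma cast_countLE_eq_sum_indicator {m : ℕ} {Ω : Type*} (p : Fin m → Ω → ℝ)
    (S : Finset (Fin m)) (s : ℝ) (ω : Ω) :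
    (countLE (fun i => p i ω) S s : ℝ) = ∑ i ∈ S, (p i ⁻¹' Set.Iic s).indicator 1 ω := by
  rw [countLE, Finset.card_filter]
  push_cast
  rfl

variable {m : ℕ} {Ω : Type*} [MeasurableSpace Ω] {P : Measure Ω} {p : Fin m → Ω → ℝ}
  {S : Finset (Fin m)} {s : ℝ}

lemma BasicIndependence.pairwiseUniform (h : BasicIndependence P p S) : PairwiseUniform P p S where
  measurable := h.measurable
  pairwise_indepFun i hi j hj hij :=
    h.indep_true.indepFun (i := ⟨i, hi⟩) (j := ⟨j, hj⟩) (by simpa using hij)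
  measure_le := h.uniform_true

namespace PairwiseUniform

variable (h : PairwiseUniform P p S)

include h

lemma measurableSet_preimage_Iic (i : Fin m) : MeasurableSet (p i ⁻¹' Set.Iic s) :=
  h.measurable i measurableSet_Iic

lemma integral_indicator (hs : s ∈ Set.Icc (0 : ℝ) 1) {i : Fin m} (hi : i ∈ S) :
    ∫ ω, (p i ⁻¹' Set.Iic s).indicator 1 ω ∂P = s := by
  rw [integral_indicator_one (h.measurableSet_preimage_Iic i)]
  exact (congrArg ENNReal.toReal (h.measure_le i hi s hs)).trans (ENNReal.toReal_ofReal hs.1)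

variable [IsProbabilityMeasure P]

lemma variance_indicator_le (hs : s ∈ Set.Icc (0 : ℝ) 1) {i : Fin m} (hi : i ∈ S) :
    Var[(p i ⁻¹' Set.Iic s).indicator 1; P] ≤ s := by
  have hmeas := h.measurableSet_preimage_Iic (s := s) i
  calc Var[(p i ⁻¹' Set.Iic s).indicator 1; P]
      ≤ ∫ ω, ((p i ⁻¹' Set.Iic s).indicator 1 ^ 2 : Ω → ℝ) ω ∂P :=
        variance_le_expectation_sq (measurable_one.indicator hmeas).aestronglyMeasurable
    _ = ∫ ω, (p i ⁻¹' Set.Iic s).indicator 1 ω ∂P := by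
        congr with ω
        by_cases hω : ω ∈ p i ⁻¹' Set.Iic s <;> simp [hω]
    _ = s := h.integral_indicator hs hi

lemma measure_abs_countLE_sub_ge_le (hs : s ∈ Set.Icc (0 : ℝ) 1) {η : ℝ} (hη : 0 < η) :
    P {ω | η ≤ |(countLE (fun i => p i ω) S s : ℝ) - S.card * s|}
      ≤ ENNReal.ofReal (S.card * s / η ^ 2) := by
  set X : Fin m → Ω → ℝ := fun i => (p i ⁻¹' Set.Iic s).indicator 1
  have hX : ∀ i ∈ S, MemLp (X i) 2 P := fun i _ =>
    memLp_indicator_const 2 (h.measurableSet_preimage_Iic i) 1 (Or.inr (measure_ne_top _ _))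
  have hmean : ∫ ω, (countLE (fun i => p i ω) S s : ℝ) ∂P = S.card * s := by
    simp only [cast_countLE_eq_sum_indicator]
    rw [integral_finsetSum _ fun i hi => (hX i hi).integrable one_le_two,
      Finset.sum_congr rfl fun i hi => h.integral_indicator hs hi, Finset.sum_const, nsmul_eq_mul]
  have hindep : (S : Set (Fin m)).Pairwise fun i j => X i ⟂ᵢ[P] X j := fun i hi j hj hij =>
    (h.pairwise_indepFun hi hj hij).comp (φ := (Set.Iic s).indicator 1)
      (ψ := (Set.Iic s).indicator 1) (measurable_one.indicator measurableSet_Iic)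
      (measurable_one.indicator measurableSet_Iic)
  have hvar : Var[∑ i ∈ S, X i; P] ≤ S.card * s :=
    calc Var[∑ i ∈ S, X i; P] = ∑ i ∈ S, Var[X i; P] := IndepFun.variance_sum hX hindep
      _ ≤ ∑ _i ∈ S, s := Finset.sum_le_sum fun i hi => h.variance_indicator_le hs hi
      _ = S.card * s := by rw [Finset.sum_const, nsmul_eq_mul]
  have hchebyshev := meas_ge_le_variance_div_sq (memLp_finsetSum' S hX) hη
  simp only [Finset.sum_apply, X, ← cast_countLE_eq_sum_indicator, hmean] at hchebyshev
  exact hchebyshev.trans (ENNReal.ofReal_le_ofReal (by gcongr))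

/-- A union bound: Chebyshev's inequality at the grid point `s = t q ^ k` fails with probability at
most `1 / (η² m s)`, which is summable in `k`. -/
lemma measure_exists_geometric_le (hm : 0 < m) {t : ℝ} (ht : 0 < t) {q : ℝ} (hq : 1 < q) {η : ℝ}
    (hη : 0 < η) :
    P {ω | ∃ k : ℕ, t * q ^ k ≤ 1 ∧ η * (m * (t * q ^ k)) ≤
        |(countLE (fun i => p i ω) S (t * q ^ k) : ℝ) - S.card * (t * q ^ k)|}
      ≤ ENNReal.ofReal (1 / (η ^ 2 * (m * t)) * (1 - q⁻¹)⁻¹) := by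
  have hq0 : 0 < q := one_pos.trans hq
  have hqinv : q⁻¹ < 1 := inv_lt_one_of_one_lt₀ hq
  rw [← tsum_geometric_of_lt_one (inv_nonneg.2 hq0.le) hqinv, ← tsum_mul_left,
    ENNReal.ofReal_tsum_of_nonneg (fun k => by positivity)
      ((summable_geometric_of_lt_one (inv_nonneg.2 hq0.le) hqinv).mul_left _),
    Set.ofPred_exists]
  refine (measure_iUnion_le _).trans (ENNReal.tsum_le_tsum fun k => ?_)
  by_cases hk : t * q ^ k ≤ 1
  · have hcard : (S.card : ℝ) ≤ m := Nat.cast_le.2 (card_finset_fin_le S)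
    calc P {ω | t * q ^ k ≤ 1 ∧ η * (m * (t * q ^ k)) ≤
            |(countLE (fun i => p i ω) S (t * q ^ k) : ℝ) - S.card * (t * q ^ k)|}
        ≤ ENNReal.ofReal (S.card * (t * q ^ k) / (η * (m * (t * q ^ k))) ^ 2) :=
          (measure_mono fun ω hω => hω.2).trans
            (h.measure_abs_countLE_sub_ge_le ⟨by positivity, hk⟩ (by positivity))
      _ ≤ ENNReal.ofReal (m * (t * q ^ k) / (η * (m * (t * q ^ k))) ^ 2) := by gcongr
      _ = ENNReal.ofReal (1 / (η ^ 2 * (m * t)) * q⁻¹ ^ k) := by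
          congr 1
          rw [inv_pow]
          field_simp
  · simp [hk]

end PairwiseUniform

end UniformNulls

/-- Monotonicity interpolates between neighbouring points of the grid; `N ≤ a` takes care of the
last grid point, which may exceed `1`. -/
lemma abs_sub_mul_le_of_geometric {N : ℝ → ℝ} (hN : Monotone N) {a b : ℝ} (hNa : ∀ s, N s ≤ a)
    (ha : 0 ≤ a) (hab : a ≤ b) {t η : ℝ} (ht : 0 < t) (hη : 0 < η) (hη1 : η ≤ 1)
    (h : ∀ k : ℕ, t * (1 + η) ^ k ≤ 1 →
      |N (t * (1 + η) ^ k) - a * (t * (1 + η) ^ k)| ≤ η * (b * (t * (1 + η) ^ k)))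
    {s : ℝ} (hs : s ∈ Set.Icc t 1) : |N s - a * s| ≤ 3 * η * (b * s) := by
  obtain ⟨k, hk, hk'⟩ := exists_nat_pow_near ((one_le_div ht).2 hs.1) (lt_add_of_pos_right 1 hη)
  rw [le_div_iff₀' ht] at hk
  rw [div_lt_iff₀' ht] at hk'
  set u := t * (1 + η) ^ k with hu
  have hu' : t * (1 + η) ^ (k + 1) = (1 + η) * u := by rw [hu]; ring
  have hb : 0 ≤ b := ha.trans hab
  have hs0 : 0 ≤ s := ht.le.trans hs.1
  have hηa : η * (a * s) ≤ η * (b * s) := by gcongr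
  have hηb : η * (η * (b * s)) ≤ 1 * (η * (b * s)) := by gcongr
  have hηb0 : 0 ≤ η * (b * s) := by positivity
  have hupper : N s ≤ (a + η * b) * ((1 + η) * s) := by
    have hnext : N s ≤ (a + η * b) * (t * (1 + η) ^ (k + 1)) := by
      rcases le_or_gt (t * (1 + η) ^ (k + 1)) 1 with hle | hgt
      · linarith [hN hk'.le, (abs_le.1 (h (k + 1) hle)).2]
      · exact (hNa s).trans ((le_add_of_nonneg_right (by positivity)).trans
          (le_mul_of_one_le_right (by positivity) hgt.le))
    exact hnext.trans (by rw [hu']; gcongr)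
  have hlower : (1 - η) * (a * s) - η * (b * s) ≤ N s := by
    have hsu : (1 - η) * s ≤ u := by
      have := mul_le_mul_of_nonneg_left (hu' ▸ hk'.le) (sub_nonneg.2 hη1)
      nlinarith [mul_nonneg (sq_nonneg η) (show 0 ≤ u by positivity)]
    have hau : (1 - η) * (a * s) ≤ a * u := by
      linarith [mul_le_mul_of_nonneg_left hsu ha]
    have hbu : η * (b * u) ≤ η * (b * s) := by gcongr
    linarith [hN hk, (abs_le.1 (h k (hk.trans hs.2))).1]
  rw [abs_le]
  constructor <;> linarith

section LawOfLargeNumbers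

variable {Ω : ℕ → Type*} [∀ m, MeasurableSpace (Ω m)] {P : ∀ m, Measure (Ω m)}
  [∀ m, IsProbabilityMeasure (P m)] {p : ∀ m, Fin m → Ω m → ℝ} {S : ∀ m, Finset (Fin m)}
  {t : ℕ → ℝ}

theorem eventually_whp_abs_countLE_sub_le
    (hp : ∀ᶠ m in atTop, PairwiseUniform (P m) (p m) (S m)) (ht : ∀ᶠ m in atTop, 0 < t m)
    (htm : Tendsto (fun m : ℕ => (m : ℝ) * t m) atTop atTop) {ε : ℝ} (hε : 0 < ε) :
    ∀ᶠ z : Σ m, Ω m in whp P, ∀ s ∈ Set.Icc (t z.1) 1,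
      |(countLE (fun i => p z.1 i z.2) (S z.1) s : ℝ) - (S z.1).card * s| ≤ ε * (z.1 * s) := by
  set η : ℝ := min (ε / 3) 1
  have hη : 0 < η := lt_min (by positivity) one_pos
  have hηε : 3 * η ≤ ε := by linarith [min_le_left (ε / 3) 1]
  have hbound : Tendsto (fun m : ℕ => ENNReal.ofReal
      (1 / (η ^ 2 * (m * t m)) * (1 - (1 + η)⁻¹)⁻¹)) atTop (𝓝 0) := by
    have := (tendsto_const_nhds (x := (1 : ℝ))).div_atTop (htm.const_mul_atTop (sq_pos_of_pos hη))
    simpa only [zero_mul, ENNReal.ofReal_zero] using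
      ENNReal.tendsto_ofReal (this.mul_const (1 - (1 + η)⁻¹)⁻¹)
  refine eventually_whp.2 (tendsto_of_tendsto_of_tendsto_of_le_of_le' tendsto_const_nhds hbound
    (.of_forall fun _ => zero_le) ?_)
  filter_upwards [hp, ht, eventually_gt_atTop 0] with m hpm htm hm
  refine (measure_mono fun ω hω => ?_).trans
    (hpm.measure_exists_geometric_le hm htm (lt_add_of_pos_right 1 hη) hη)
  by_contra! hgrid
  refine hω fun s hs => (abs_sub_mul_le_of_geometric
    (fun _ _ hst => Nat.cast_le.2 (countLE_mono _ _ hst))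
    (fun _ => Nat.cast_le.2 (countLE_le_card _ _ _)) (Nat.cast_nonneg _)
    (Nat.cast_le.2 (card_finset_fin_le _)) htm hη (min_le_right _ _)
    (fun k hk => ?_) hs).trans ?_
  · exact (not_le.1 fun hle => hgrid ⟨k, hk, hle⟩).le
  · have hs0 : 0 ≤ s := htm.le.trans hs.1
    gcongr

/-- The points `s z` may be random and may depend on all p-values, since the estimate holds
uniformly on `[t m, 1]`. -/
theorem tendsto_countLE_div (hp : ∀ᶠ m in atTop, PairwiseUniform (P m) (p m) (S m))
    (ht : ∀ᶠ m in atTop, 0 < t m) (htm : Tendsto (fun m : ℕ => (m : ℝ) * t m) atTop atTop) {κ : ℝ}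
    (hκ : Tendsto (fun m : ℕ => ((S m).card : ℝ) / m) atTop (𝓝 κ)) {s : (Σ m, Ω m) → ℝ}
    (hs : ∀ᶠ z in whp P, s z ∈ Set.Icc (t z.1) 1) :
    Tendsto (fun z => (countLE (fun i => p z.1 i z.2) (S z.1) (s z) : ℝ) / (z.1 * s z)) (whp P)
      (𝓝 κ) := by
  refine (hκ.comp tendsto_fst_whp).congr_dist (Metric.tendsto_nhds.2 fun ε hε => ?_)
  filter_upwards [hs, eventually_whp_abs_countLE_sub_le hp ht htm (half_pos hε),
    tendsto_fst_whp.eventually ht, tendsto_fst_whp.eventually (eventually_gt_atTop 0)]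
    with z hsz hz htz hm
  have hs0 : 0 < s z := htz.trans_le hsz.1
  have hms : 0 < (z.1 : ℝ) * s z := by positivity
  have hdiff : ((S z.1).card : ℝ) / z.1 -
      (countLE (fun i => p z.1 i z.2) (S z.1) (s z) : ℝ) / (z.1 * s z) =
      -(((countLE (fun i => p z.1 i z.2) (S z.1) (s z) : ℝ) - (S z.1).card * s z) /
        (z.1 * s z)) := by
    field_simp
    ring
  rw [Real.dist_0_eq_abs, abs_of_nonneg dist_nonneg, Function.comp_apply, Real.dist_eq, hdiff,
    abs_neg, abs_div, abs_of_pos hms, div_lt_iff₀ hms]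
  exact (hz (s z) hsz).trans_lt (by nlinarith)

end LawOfLargeNumbers

section AlongFilter

variable {Z : Type*} {l : Filter Z} {n : Z → ℕ} {x : ∀ z, Fin (n z) → ℝ}
  {S : ∀ z, Finset (Fin (n z))} {M t : Z → ℝ} {α lam κ C₀ : ℝ}

/-- With `N s` the number of values `≤ s`, the lower bound on the complement of `S` lifts
`N t / (n t)` to at least `M / (n α)` in the limit, so the line `s ↦ s M / α` has already fallen
below `N` at `s = t`. -/
lemma eventually_le_cutoff_critVal (hα : 0 < α) (hM : ∀ᶠ z in l, 0 < M z)
    (ht : ∀ᶠ z in l, t z ∈ Set.Ioc 0 lam)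
    (hN : Tendsto (fun z => (countLE (x z) (S z) (t z) : ℝ) / (n z * t z)) l (𝓝 κ))
    (hC₀ : Tendsto (fun z => M z / n z) l (𝓝 C₀)) {δ : ℝ} (hδ : 0 < δ)
    (hcompl : ∀ᶠ z in l, δ - κ + 1 / α * C₀ ≤
      ((S z)ᶜ.card : ℝ) / n z * (ecdf (x z) (S z)ᶜ (t z) / t z)) :
    ∀ᶠ z in l, t z ≤ cutoff (x z) (critVal α lam (M z)) := by
  have hgap : ∀ᶠ z in l, κ - 1 / α * C₀ - δ <
      (countLE (x z) (S z) (t z) : ℝ) / (n z * t z) - 1 / α * (M z / n z) :=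
    (hN.sub (hC₀.const_mul (1 / α))).eventually_const_lt (sub_lt_self _ hδ)
  filter_upwards [hM, ht, hgap, hcompl] with z hMz htz hgapz hcomplz
  refine le_cutoff_critVal (x z) hα.le hMz htz.1.le htz.2 ?_
  rw [div_mul_div_comm, card_mul_ecdf] at hcomplz
  have hlt : 1 / α * (M z / n z) < (countLE (x z) Finset.univ (t z) : ℝ) / (n z * t z) := by
    rw [← countLE_add_countLE_compl (x z) (S z), Nat.cast_add, add_div]
    linarith
  have hlt' : M z / α * (n z : ℝ)⁻¹ <
      (countLE (x z) Finset.univ (t z) : ℝ) / t z * (n z : ℝ)⁻¹ := by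
    convert hlt using 1 <;> ring
  have := lt_of_mul_lt_mul_right hlt' (by positivity)
  rw [div_lt_div_iff₀ hα htz.1] at this
  linarith

lemma mul_le_of_tendsto_div [l.NeBot] (hα : 0 ≤ α) (hlam : 0 < lam)
    (hN : Tendsto (fun z => (countLE (x z) (S z) lam : ℝ) / (n z * lam)) l (𝓝 κ))
    (hC₀ : Tendsto (fun z => M z / n z) l (𝓝 C₀))
    (hM : ∀ᶠ z in l, α * countLE (x z) Finset.univ lam ≤ lam * M z) : α * κ ≤ C₀ := by
  refine le_of_tendsto_of_tendsto (hN.const_mul α) hC₀ (hM.mono fun z hz => ?_)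
  have hle : (countLE (x z) (S z) lam : ℝ) ≤ countLE (x z) Finset.univ lam :=
    Nat.cast_le.2 (countLE_le_countLE_univ _ _ _)
  calc α * ((countLE (x z) (S z) lam : ℝ) / (n z * lam))
      = α * countLE (x z) (S z) lam / lam / n z := by ring
    _ ≤ M z / n z := by
      gcongr
      rw [div_le_iff₀' hlam]
      exact le_trans (by gcongr) hz

lemma tendsto_fdp_critVal (hα : 0 < α) (hlam : 0 ≤ lam) (hM : ∀ᶠ z in l, 0 < M z)
    (hN : Tendsto (fun z => (countLE (x z) (S z) (cutoff (x z) (critVal α lam (M z))) : ℝ) /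
      (n z * cutoff (x z) (critVal α lam (M z)))) l (𝓝 κ))
    (hC₀ : Tendsto (fun z => M z / n z) l (𝓝 C₀)) (hC₀0 : C₀ ≠ 0)
    (hMlam : ∀ᶠ z in l, α * countLE (x z) Finset.univ lam ≤ lam * M z) :
    Tendsto (fun z => fdp (x z) (S z) (critVal α lam (M z))) l (𝓝 (α * (κ / C₀))) := by
  refine ((hN.div hC₀ hC₀0).const_mul α).congr' ?_
  filter_upwards [hM, hMlam, hC₀.eventually_ne hC₀0] with z hMz hMlamz hdiv
  have hn : (n z : ℝ) ≠ 0 := (div_ne_zero_iff.1 hdiv).2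
  rw [fdp_critVal_eq (x z) (S z) hα hlam hMz hMlamz]
  simp only [Pi.div_apply]
  field_simp

lemma tendsto_countLE_atTop (hκ : 0 < κ)
    (hN : Tendsto (fun z => (countLE (x z) (S z) (t z) : ℝ) / (n z * t z)) l (𝓝 κ))
    (hnt : Tendsto (fun z => (n z : ℝ) * t z) l atTop) {s : Z → ℝ} (hts : ∀ᶠ z in l, t z ≤ s z) :
    Tendsto (fun z => (countLE (x z) (S z) (s z) : ℝ)) l atTop := by
  refine tendsto_atTop_mono' l ?_ (hN.pos_mul_atTop hκ hnt)
  filter_upwards [hts, hnt.eventually_gt_atTop 0] with z htsz hntz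
  rw [div_mul_cancel₀ _ hntz.ne']
  exact Nat.cast_le.2 (countLE_mono _ _ htsz)

end AlongFilter

lemma tendsto_prob_mul_le {Ω : ℕ → Type*} [∀ m, MeasurableSpace (Ω m)] {P : ∀ m, Measure (Ω m)}
    [∀ m, IsProbabilityMeasure (P m)] {N M : ∀ m, Ω m → ℝ} (hN : ∀ m ω, 0 ≤ N m ω) {α lam C : ℝ}
    (hα : 0 ≤ α) (hlam : 0 < lam) (hC : 1 ≤ C)
    (h : Tendsto (fun m => P m {ω | C * α / lam * max (N m ω) 1 ≤ M m ω}) atTop (𝓝 1)) :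
    Tendsto (fun m => P m {ω | α * N m ω ≤ lam * M m ω}) atTop (𝓝 1) := by
  refine tendsto_of_tendsto_of_tendsto_of_le_of_le h tendsto_const_nhds
    (fun m => measure_mono fun ω hω => ?_) fun m => prob_le_one
  have hN0 := hN m ω
  rw [Set.mem_ofPred_eq, div_mul_eq_mul_div, div_le_iff₀' hlam] at hω
  calc α * N m ω ≤ C * (α * N m ω) := le_mul_of_one_le_left (by positivity) hC
    _ ≤ C * α * max (N m ω) 1 := by
      rw [← mul_assoc]
      gcongr
      exact le_max_left _ _
    _ ≤ lam * M m ω := hω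

end StepUp

open StepUp in
theorem theorem5p3_general {Ω : ℕ → Type*} [∀ m, MeasurableSpace (Ω m)] (P : ∀ m, Measure (Ω m))
    [∀ m, IsProbabilityMeasure (P m)] (p : ∀ m, Fin m → Ω m → ℝ) (I₀ : ∀ m, Finset (Fin m))
    (hp : ∀ᶠ m in atTop, PairwiseUniform (P m) (p m) (I₀ m))
    {α lam : ℝ} (hα : 0 < α) (hlam0 : 0 < lam) (hlam1 : lam ≤ 1)
    (M : ∀ m, Ω m → ℝ) (hM_meas : ∀ᶠ m in atTop, Measurable (M m))
    (hM_pos : ∀ᶠ m in atTop, ∀ ω, 0 < M m ω)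
    {κ₀ : ℝ} (hκ₀ : 0 < κ₀)
    (hA1 : Tendsto (fun m : ℕ => ((I₀ m).card : ℝ) / (m : ℝ)) atTop (𝓝 κ₀))
    (hA4 : Tendsto (fun m => P m {ω |
      α * countLE (fun i => p m i ω) Finset.univ lam ≤ lam * M m ω}) atTop (𝓝 1))
    {C₀ : ℝ} (hC₀ : TendstoInProb P (fun m ω => M m ω / (m : ℝ)) C₀)
    {δ : ℝ} (hδ : 0 < δ) {t : ℕ → ℝ} (ht : ∀ᶠ m in atTop, t m ∈ Set.Ioc 0 lam)
    (htm : Tendsto (fun m : ℕ => (m : ℝ) * t m) atTop atTop)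
    (hF1 : Tendsto (fun m => P m {ω | δ - κ₀ + 1 / α * C₀ ≤
      ((I₀ m)ᶜ.card : ℝ) / (m : ℝ) * (ecdf (fun i => p m i ω) (I₀ m)ᶜ (t m) / t m)})
      atTop (𝓝 1)) :
    TendstoInftyInProb P (fun m ω => (countLE (fun i => p m i ω) (I₀ m)
        (cutoff (fun i => p m i ω) (critVal α lam (M m ω))) : ℝ)) ∧
      TendstoInProb P (fun m ω => fdp (fun i => p m i ω) (I₀ m) (critVal α lam (M m ω))
        - ∫ ω', fdp (fun i => p m i ω') (I₀ m) (critVal α lam (M m ω')) ∂(P m)) 0 := by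
  rw [tendstoInProb_iff] at hC₀
  have ht_whp := tendsto_fst_whp (P := P).eventually ht
  have hM_whp : ∀ᶠ z : Σ m, Ω m in whp P, 0 < M z.1 z.2 :=
    (tendsto_fst_whp.eventually hM_pos).mono fun z hz => hz z.2
  have hA4_whp := eventually_whp_of_tendsto_one (hp.and hM_meas |>.mono fun m h =>
    measurableSet_le ((measurable_cast_countLE h.1.measurable _ measurable_const).const_mul α)
      (h.2.const_mul lam)) hA4
  have hF1_whp := eventually_whp_of_tendsto_one (hp.mono fun m h => measurableSet_le
    measurable_const (((measurable_ecdf h.measurable _ (t m)).div_const _).const_mul _)) hF1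
  have hlln : ∀ s : (Σ m, Ω m) → ℝ, (∀ᶠ z in whp P, s z ∈ Set.Icc (t z.1) lam) →
      Tendsto (fun z => (countLE (fun i => p z.1 i z.2) (I₀ z.1) (s z) : ℝ) / (z.1 * s z))
        (whp P) (𝓝 κ₀) := fun s hs =>
    tendsto_countLE_div hp (ht.mono fun m h => h.1) htm hA1
      (hs.mono fun z h => ⟨h.1, h.2.trans hlam1⟩)
  have hN_t := hlln (fun z => t z.1) (ht_whp.mono fun z h => ⟨le_rfl, h.2⟩)
  have hN_lam := hlln (fun _ => lam) (ht_whp.mono fun z h => ⟨h.2, le_rfl⟩)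
  have hcut := eventually_le_cutoff_critVal hα hM_whp ht_whp hN_t hC₀ hδ hF1_whp
  have hN_cut := hlln _ (hcut.mono fun z h => ⟨h, cutoff_critVal_le _⟩)
  have hC₀_pos : 0 < C₀ :=
    (mul_pos hα hκ₀).trans_le (mul_le_of_tendsto_div hα.le hlam0 hN_lam hC₀ hA4_whp)
  refine ⟨tendstoInftyInProb_of_tendsto (tendsto_countLE_atTop hκ₀ hN_t
    (htm.comp tendsto_fst_whp) hcut), tendstoInProb_sub_integral (b := 1) ?_ ?_
    (tendsto_fdp_critVal hα hlam0.le hM_whp hN_cut hC₀ hC₀_pos.ne' hA4_whp)⟩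
  · exact hp.and hM_meas |>.mono fun m h => measurable_fdp h.1.measurable _
      (fun _ => critVal_zero_nonneg hlam0.le) (measurable_critVal α lam h.2)
  · exact hM_pos.mono fun m h ω =>
      abs_fdp_le_one _ _ (critVal_zero_nonneg hlam0.le) (critVal_mono hα.le (h ω).le)

theorem theorem5p3
    -- the multiple testing problems, one for each number `m ≥ 1` of hypotheses
    {Ω : ℕ → Type*} [∀ m, MeasurableSpace (Ω m)] (P : ∀ m, Measure (Ω m))
    [∀ m, IsProbabilityMeasure (P m)]
    (p : ∀ m, Fin m → Ω m → ℝ) (I₀ : ∀ m, Finset (Fin m))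
    (hBI : ∀ m, 0 < m → StepUp.BasicIndependence (P m) (p m) (I₀ m))
    -- the level, the tuning parameter and the estimators
    (α lam : ℝ) (hα0 : 0 < α) (hα1 : α < 1) (hαlam : α ≤ lam) (hlam1 : lam < 1)
    (est : ℕ → (Set.Ici lam → ℝ) → ℝ)
    (hest_meas : ∀ m, 0 < m → Measurable (est m))
    (hest_pos : ∀ m, 0 < m → ∀ ω, 0 < StepUp.mHat lam (est m) (fun i => p m i ω))
    -- `m₀ / m → κ₀ ∈ (0, 1]`
    (κ₀ : ℝ) (hκ₀ : κ₀ ∈ Set.Ioc (0 : ℝ) 1)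
    (hA1 : Tendsto (fun m : ℕ => ((I₀ m).card : ℝ) / (m : ℝ)) atTop (𝓝 κ₀))
    -- `m̂₀ ≤ K m` for some `K > 0`
    (hA3 : ∃ K : ℝ, 0 < K ∧ ∀ m : ℕ, 0 < m → ∀ ω,
      StepUp.mHat lam (est m) (fun i => p m i ω) ≤ K * (m : ℝ))
    -- `m̂₀ ≥ (C α / lam) max (R_m(lam), 1)` with probability tending to one, for some `C > 1`
    (hA4 : ∃ C : ℝ, 1 < C ∧ Tendsto (fun m => P m {ω |
      C * α / lam * max (StepUp.countLE (fun i => p m i ω) Finset.univ lam : ℝ) 1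
        ≤ StepUp.mHat lam (est m) (fun i => p m i ω)}) atTop (𝓝 1))
    -- `m̂₀ / m → C₀` in probability
    (C₀ : ℝ)
    (hC₀ : StepUp.TendstoInProb P
      (fun m ω => StepUp.mHat lam (est m) (fun i => p m i ω) / (m : ℝ)) C₀)
    -- the sequence `t_m`
    (δ : ℝ) (hδ : 0 < δ) (t : ℕ → ℝ) (ht : ∀ m, 0 < m → t m ∈ Set.Ioo 0 lam)
    (htm : Tendsto (fun m : ℕ => (m : ℝ) * t m) atTop atTop)
    (hF1 : Tendsto (fun m => P m {ω |
      δ - κ₀ + 1 / α * C₀ ≤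
        (((I₀ m)ᶜ.card : ℝ) / (m : ℝ)) *
          (StepUp.ecdf (fun i => p m i ω) (I₀ m)ᶜ (t m) / t m)}) atTop (𝓝 1)) :
    StepUp.TendstoInftyInProb P
        (fun m ω => (StepUp.V α lam (est m) (I₀ m) (fun i => p m i ω) : ℝ)) ∧
      StepUp.Consistent P p I₀ α lam est := by
  obtain ⟨C, hC, hA4⟩ := hA4
  have hm := eventually_gt_atTop (0 : ℕ)
  have hlam := hα0.trans_le hαlam
  exact theorem5p3_general P p I₀ (hm.mono fun m h => (hBI m h).pairwiseUniform) hα0 hlam hlam1.le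
    (fun m ω => StepUp.mHat lam (est m) fun i => p m i ω)
    (hm.mono fun m h => StepUp.measurable_mHat (hBI m h).measurable (hest_meas m h))
    (hm.mono hest_pos) hκ₀.1 hA1
    (StepUp.tendsto_prob_mul_le (fun _ _ => Nat.cast_nonneg _) hα0.le hlam hC.le hA4) hC₀ hδ
    (hm.mono fun m h => Set.Ioo_subset_Ioc_self (ht m h)) htm hF1
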